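/- Let $SU(2)$ be the group of $2\times 2$ complex unitary matrices of determinant $1$, with normalized Haar measure $\mu$ and the bi-invariant metric $$d(x,y)=\sqrt{\tfrac12\,\mathrm{tr}\big((x-y)(x-y)^*\big)} .$$ For $\alpha\in(0,1)$ let $\mathrm{Lip}_\alpha(SU(2))$ be the set of functions $f:SU(2)\to\mathbb R$ for which there is $M>0$ with $|f(x)-f(y)|\le M\,d(x,y)^\alpha$ for all $x,y\in SU(2)$. For $n=0,1,2,\dots$ let $\pi_n$ be the irreducible continuous unitary representation of $SU(2)$ of dimension $n+1$ (unique up to equivalence; it is realized on the homogeneous complex polynomials of degree $n$ in $z=(z_1,z_2)$ by $(\pi_n(g)p)(z)=p(zg)$), and let $\chi_n=\mathrm{tr}\,\pi_n$ be its character. The Dirichlet kernel and the Fourier partial sums of $f$ are $$\mathbf D_N=\sum_{n=0}^{N}(n+1)\chi_n,\qquad S_Nf(x)=(\mathbf D_N*f)(x)=\int_{SU(2)}\mathbf D_N(y)\,f(y^{-1}x)\,d\mu(y).$$ Theorem. Let $\alpha\in(0,1)$ and let $E$ be any countable subset of $SU(2)$. Then there exists a function $f\in\mathrm{Lip}_\alpha(SU(2))$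 such that $$\sup_{N\ge 1}|S_Nf(x)|=\infty\qquad\text{for every } x\in E .$$ -/

import Mathlib

noncomputable section

namespace SUTwo

open MeasureTheory MvPolynomial

/-- The group `SU(2)` of unitary `2 × 2` complex matrices of determinant one, with the topology
and the group structure coming from the matrices. -/
abbrev SU2 : Type := Matrix.specialUnitaryGroup (Fin 2) ℂ

/-- The Borel `σ`-algebra of `SU(2)`. -/
instance instMeasurableSpace : MeasurableSpace SU2 := borel SU2

instance instBorelSpace : BorelSpace SU2 := ⟨rfl⟩

instance instIsTopologicalGroup : IsTopologicalGroup SU2 where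
  continuous_inv := by
    have h : Continuous fun g : SU2 => star (g : Matrix (Fin 2) (Fin 2) ℂ) :=
      continuous_star.comp continuous_subtype_val
    exact h.subtype_mk _

instance instCompactSpace : CompactSpace SU2 := by
  have hK : IsCompact (Set.pi Set.univ fun _ : Fin 2 =>
      Set.pi Set.univ fun _ : Fin 2 => Metric.closedBall (0 : ℂ) 1) :=
    isCompact_univ_pi fun _ => isCompact_univ_pi fun _ => isCompact_closedBall 0 1
  have hU : IsClosed {A : Matrix (Fin 2) (Fin 2) ℂ | A * star A = 1 ∧ A.det = 1} := by
    refine IsClosed.inter (isClosed_eq (by fun_prop) continuous_const)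
      (isClosed_eq (by fun_prop) continuous_const)
  refine isCompact_iff_compactSpace.mp (hK.of_isClosed_subset (t := _) ?_ ?_)
  · have hE : (Matrix.specialUnitaryGroup (Fin 2) ℂ : Set (Matrix (Fin 2) (Fin 2) ℂ)) =
        {A | A * star A = 1 ∧ A.det = 1} := by
      refine Set.ext fun A => ?_
      simp [Matrix.mem_specialUnitaryGroup_iff, Matrix.mem_unitaryGroup_iff]
    exact hE ▸ hU
  · intro A hA i _ j _
    have := entry_norm_bound_of_unitary (Matrix.mem_specialUnitaryGroup_iff.mp hA).1 i j
    simpa using this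

/-- The normalized Haar measure of the compact group `SU(2)`: the Haar measure of total mass `1`. -/
def haar : Measure SU2 :=
  Measure.haarMeasure ⟨⟨Set.univ, isCompact_univ⟩, by simp⟩

/-- The bi-invariant metric `d(x, y) = √(½ tr ((x - y)(x - y)*))` of `SU(2)`. -/
def dist (x y : SU2) : ℝ :=
  Real.sqrt ((1 / 2 : ℝ) * (Matrix.trace
    (((x : Matrix (Fin 2) (Fin 2) ℂ) - (y : Matrix (Fin 2) (Fin 2) ℂ)) *
      ((x : Matrix (Fin 2) (Fin 2) ℂ) - (y : Matrix (Fin 2) (Fin 2) ℂ)).conjTranspose)).re)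

/-- `f ∈ Lip_α(SU(2))`: the real function `f` is `α`-Hölder continuous for the metric `d`. -/
def IsHolder (α : ℝ) (f : SU2 → ℝ) : Prop :=
  ∃ M : ℝ, 0 < M ∧ ∀ x y : SU2, |f x - f y| ≤ M * dist x y ^ α

/-- The substitution `p(z) ↦ p(z g)` on complex polynomials in `z = (z₀, z₁)`, where `z g` is the
product of the row vector `z` with the matrix `g`. -/
def subst (g : Matrix (Fin 2) (Fin 2) ℂ) :
    MvPolynomial (Fin 2) ℂ →ₐ[ℂ] MvPolynomial (Fin 2) ℂ :=
  aeval fun j => ∑ i, C (g i j) * X i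

theorem subst_one : subst 1 = AlgHom.id ℂ _ := by
  refine algHom_ext fun j => ?_
  fin_cases j <;> simp [subst]

theorem subst_mul (g h : Matrix (Fin 2) (Fin 2) ℂ) :
    subst (g * h) = (subst g).comp (subst h) := by
  refine algHom_ext fun j => ?_
  simp only [subst, Matrix.mul_apply, Fin.sum_univ_two, aeval_X, AlgHom.comp_apply, map_add,
    map_mul, algHom_C, algebraMap_eq]
  ring

theorem subst_mem (g : Matrix (Fin 2) (Fin 2) ℂ) {n : ℕ} (p : MvPolynomial (Fin 2) ℂ)
    (hp : p ∈ homogeneousSubmodule (Fin 2) ℂ n) :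
    (subst g).toLinearMap p ∈ homogeneousSubmodule (Fin 2) ℂ n := by
  have h := IsHomogeneous.aeval (R := ℂ) (S := ℂ) (n := 1) hp
    (fun j : Fin 2 => ∑ i, C (g i j) * X i)
    (fun j => IsHomogeneous.sum _ _ _ fun i _ => (isHomogeneous_X ℂ i).C_mul (g i j))
  rw [one_mul] at h
  exact h

/-- The irreducible representation `π_n` of `SU(2)` of dimension `n + 1`, realized on the space of
homogeneous polynomials of degree `n` in two complex variables by `(π_n(g) p)(z) = p(z g)`.
For `n = 0, 1, 2, …` these are, up to equivalence, all the continuous irreducible unitary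
representations of `SU(2)`, each occurring once. -/
def irrep (n : ℕ) : Representation ℂ SU2 (homogeneousSubmodule (Fin 2) ℂ n) where
  toFun g := (subst (g : Matrix (Fin 2) (Fin 2) ℂ)).toLinearMap.restrict (subst_mem _)
  map_one' := by
    ext p : 2
    simp [LinearMap.restrict_apply, subst_one]
  map_mul' g h := by
    ext p : 2
    simp [LinearMap.restrict_apply, subst_mul]

/-- The Dirichlet kernel `D_N = ∑_{n=0}^N d_n χ_n`, where `d_n = n + 1` is the degree of `π_n` and
`χ_n = tr π_n` is its character. -/
def dirichletKernel (N : ℕ) (x : SU2) : ℂ :=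
  ∑ n ∈ Finset.range (N + 1), ((n : ℂ) + 1) * (irrep n).character x

/-- The Fourier partial sum `S_N f (x) = (D_N ∗ f)(x) = ∫ D_N(y) f(y⁻¹ x) dμ(y)`. -/
def fourierPartialSum (N : ℕ) (f : SU2 → ℝ) (x : SU2) : ℂ :=
  ∫ y, dirichletKernel N y * (f (y⁻¹ * x) : ℂ) ∂haar

end SUTwo

end

/-!
The linear functionals `f ↦ S_N f (x)` are not uniformly bounded on the unit ball of `Lip_α`, and
condensation of singularities over the points of `E` then gives the function.

Let `e ^ (± i θ)` be the eigenvalues of `y ∈ SU(2)`. Then `2 cos (m θ) = χ_m - χ_{m - 2}`, and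
cutting the Fourier series off at `N = m - 1` keeps `-χ_{m - 2}` only, whose value at the identity
is `-(m - 1)`. On the other hand `θ ↦ 2 cos (m θ)` is bounded by `2` and has Lipschitz constant at
most `2 m`, so its Hölder seminorm is at most `4 m ^ α` (`abs_cosine_sub_le`). Dividing by this
gives functions in the Hölder ball with `|S_{m - 1} f|` at least of order `m ^ (1 - α)` at the
identity, and right translations move the identity to any point
(`exists_lt_norm_fourierPartialSum`).

The Lipschitz bound holds because the map from `x` to its eigenvalue in the upper half plane is a
contraction (`norm_eigenvalue_sub_le`). The partial sum is computed from
`2 cos (m θ) χ_n = χ_{m + n} - χ_{m - n - 2}` and `∫ χ_n = 0` for `n > 0` (`integral_character`).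
The integral vanishes because the average of a binary form over `SU(2)` is an invariant form, and
there are no nonzero invariant forms of positive degree (`integral_coeff_subst`).

The last step is Baire's theorem on the Hölder ball, a complete bounded convex set of continuous
functions: if every function in it had bounded partial sums at some point of `E`, then the partial
sums at some point of `E` would be uniformly bounded near some function of the ball, hence, by
convexity, on the whole ball (`exists_mem_forall_unbounded`).
-/

noncomputable section

namespace SUTwo

open MeasureTheory ComplexConjugate

/-! ### Entries and eigenvalues of elements of `SU(2)` -/

theorem star_eq_adjugate (x : SU2) :
    star (x : Matrix (Fin 2) (Fin 2) ℂ) = (x : Matrix (Fin 2) (Fin 2) ℂ).adjugate := by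
  obtain ⟨hu, hd⟩ := Matrix.mem_specialUnitaryGroup_iff.mp x.2
  have h1 := Matrix.mem_unitaryGroup_iff'.mp hu
  have h2 := Matrix.mul_adjugate (x : Matrix (Fin 2) (Fin 2) ℂ)
  rw [hd, one_smul] at h2
  calc star (x : Matrix (Fin 2) (Fin 2) ℂ)
      = star (x : Matrix (Fin 2) (Fin 2) ℂ) * (x.1 * x.1.adjugate) := by rw [h2, mul_one]
    _ = x.1.adjugate := by rw [← mul_assoc, h1, one_mul]

theorem apply_one_zero (x : SU2) : x.1 1 0 = -conj (x.1 0 1) := by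
  have h := congrFun (congrFun (star_eq_adjugate x) 1) 0
  rw [Matrix.adjugate_fin_two] at h
  simp only [Matrix.star_apply, Matrix.of_apply, Matrix.cons_val', Matrix.cons_val_zero,
    Matrix.cons_val_one, Matrix.cons_val_fin_one, RCLike.star_def] at h
  rw [h, neg_neg]

theorem apply_one_one (x : SU2) : x.1 1 1 = conj (x.1 0 0) := by
  have h := congrFun (congrFun (star_eq_adjugate x) 0) 0
  rw [Matrix.adjugate_fin_two] at h
  simpa using h.symm

theorem normSq_add_normSq (x : SU2) :
    Complex.normSq (x.1 0 0) + Complex.normSq (x.1 0 1) = 1 := by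
  have hd := (Matrix.mem_specialUnitaryGroup_iff.mp x.2).2
  rw [Matrix.det_fin_two, apply_one_zero, apply_one_one, mul_neg, sub_neg_eq_add,
    Complex.mul_conj, Complex.mul_conj] at hd
  exact_mod_cast hd

/-- The element of `SU(2)` with first row `(a, b)`. -/
def ofRow (a b : ℂ) (h : Complex.normSq a + Complex.normSq b = 1) : SU2 :=
  ⟨!![a, b; -conj b, conj a], by
    have h' : a * conj a + b * conj b = 1 := by
      rw [Complex.mul_conj, Complex.mul_conj]; exact_mod_cast h
    rw [Matrix.mem_specialUnitaryGroup_iff, Matrix.mem_unitaryGroup_iff]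
    refine ⟨?_, ?_⟩
    · ext i j
      fin_cases i <;> fin_cases j <;>
        simp [Matrix.mul_apply, Fin.sum_univ_two, Matrix.star_apply] <;>
        first | linear_combination h' | ring
    · rw [Matrix.det_fin_two_of]
      linear_combination h'⟩

theorem coe_ofRow (a b : ℂ) (h : Complex.normSq a + Complex.normSq b = 1) :
    (ofRow a b h).1 = !![a, b; -conj b, conj a] := rfl

theorem inv_apply_zero_zero (x : SU2) : (x⁻¹).1 0 0 = conj (x.1 0 0) := rfl

/-- The eigenvalue of `x ∈ SU(2)` in the closed upper half plane; it is `t + i √(1 - t²)` where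
`2 t` is the trace of `x`. -/
def eigenvalue (x : SU2) : ℂ := ⟨(x.1 0 0).re, Real.sqrt (1 - (x.1 0 0).re ^ 2)⟩

theorem re_sq_le_one (x : SU2) : (x.1 0 0).re ^ 2 ≤ 1 := by
  have h := normSq_add_normSq x
  have := Complex.normSq_nonneg (x.1 0 1)
  rw [Complex.normSq_apply] at h
  nlinarith [sq_nonneg (x.1 0 0).im]

theorem normSq_eigenvalue (x : SU2) : Complex.normSq (eigenvalue x) = 1 := by
  rw [Complex.normSq_apply, eigenvalue]
  have := Real.mul_self_sqrt (sub_nonneg.mpr (re_sq_le_one x))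
  simp only
  linarith

theorem eigenvalue_mul_conj (x : SU2) : eigenvalue x * conj (eigenvalue x) = 1 := by
  rw [Complex.mul_conj, normSq_eigenvalue, Complex.ofReal_one]

theorem norm_eigenvalue (x : SU2) : ‖eigenvalue x‖ = 1 := by
  rw [Complex.norm_def, normSq_eigenvalue, Real.sqrt_one]

theorem eigenvalue_inv (x : SU2) : eigenvalue x⁻¹ = eigenvalue x := by
  simp [eigenvalue, inv_apply_zero_zero]

theorem continuous_apply (i j : Fin 2) : Continuous fun x : SU2 => x.1 i j :=
  (continuous_subtype_val).matrix_elem i j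

theorem continuous_eigenvalue : Continuous eigenvalue := by
  have h : Continuous fun x : SU2 => (x.1 0 0).re :=
    Complex.continuous_re.comp (continuous_apply 0 0)
  have : eigenvalue = fun x : SU2 =>
      (((x.1 0 0).re : ℝ) : ℂ) + (Real.sqrt (1 - (x.1 0 0).re ^ 2) : ℝ) * Complex.I := by
    funext x
    exact Complex.mk_eq_add_mul_I _ _
  rw [this]
  fun_prop

/-- Every element of `SU(2)` is conjugate within `SU(2)` to a diagonal matrix. -/
theorem exists_conj_diagonal (x : SU2) :
    ∃ h d : SU2, x = h * d * h⁻¹ ∧ d.1 = !![eigenvalue x, 0; 0, conj (eigenvalue x)] := by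
  set l := eigenvalue x with hl
  have hlc := eigenvalue_mul_conj x
  have hsum : l + conj l = x.1 0 0 + conj (x.1 0 0) := by
    rw [Complex.add_conj, Complex.add_conj, hl, eigenvalue]
  have hx : x.1 0 0 * conj (x.1 0 0) + x.1 0 1 * conj (x.1 0 1) = 1 := by
    rw [Complex.mul_conj, Complex.mul_conj]; exact_mod_cast normSq_add_normSq x
  have hdet : (x.1 - l • (1 : Matrix (Fin 2) (Fin 2) ℂ)).det = 0 := by
    rw [Matrix.det_fin_two]
    simp [apply_one_zero, apply_one_one]
    linear_combination hx - hlc + l * hsum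
  obtain ⟨v, hv0, hv⟩ := Matrix.exists_mulVec_eq_zero_iff.mpr hdet
  have e0 : x.1 0 0 * v 0 + x.1 0 1 * v 1 = l * v 0 := by
    have := congrFun hv 0
    simp [Matrix.mulVec, dotProduct, Fin.sum_univ_two] at this
    linear_combination this
  have e1 : -conj (x.1 0 1) * v 0 + conj (x.1 0 0) * v 1 = l * v 1 := by
    have := congrFun hv 1
    simp [Matrix.mulVec, dotProduct, Fin.sum_univ_two, apply_one_zero, apply_one_one] at this
    linear_combination this
  have hpos : 0 < Complex.normSq (v 0) + Complex.normSq (v 1) := by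
    rcases (add_nonneg (Complex.normSq_nonneg (v 0)) (Complex.normSq_nonneg (v 1))).lt_or_eq
      with h | h
    · exact h
    · refine absurd ?_ hv0
      have h0 : Complex.normSq (v 0) = 0 := by
        linarith [Complex.normSq_nonneg (v 0), Complex.normSq_nonneg (v 1)]
      have h1 : Complex.normSq (v 1) = 0 := by linarith
      funext i
      fin_cases i
      · exact Complex.normSq_eq_zero.mp h0
      · exact Complex.normSq_eq_zero.mp h1
  set r : ℝ := (Real.sqrt (Complex.normSq (v 0) + Complex.normSq (v 1)))⁻¹ with hr
  have hr2 : r * r * (Complex.normSq (v 0) + Complex.normSq (v 1)) = 1 := by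
    rw [hr, ← mul_inv, Real.mul_self_sqrt hpos.le, inv_mul_cancel₀ hpos.ne']
  -- the columns of `h` are the unit eigenvector `r v` and its orthogonal complement in `ℂ²`
  let h : SU2 := ofRow (r * v 0) (-conj (r * v 1)) (by
    simp only [Complex.normSq_neg, Complex.normSq_conj, Complex.normSq_mul, Complex.normSq_ofReal]
    linarith)
  let d : SU2 := ofRow l 0 (by simp [hl, normSq_eigenvalue])
  have c0 := congrArg conj e0
  have c1 := congrArg conj e1
  simp only [map_add, map_mul, map_neg, Complex.conj_conj] at c0 c1
  refine ⟨h, d, ?_, by simp [d, coe_ofRow]⟩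
  rw [eq_mul_inv_iff_mul_eq]
  apply Subtype.ext
  change x.1 * h.1 = h.1 * d.1
  simp only [h, d, coe_ofRow]
  ext i j
  fin_cases i <;> fin_cases j <;>
    simp [Matrix.mul_apply, Fin.sum_univ_two, apply_one_zero, apply_one_one]
  · linear_combination (r : ℂ) * e0
  · linear_combination -(r : ℂ) * c1
  · linear_combination (r : ℂ) * e1
  · linear_combination (r : ℂ) * c0

/-! ### The metric -/

theorem dist_nonneg (x y : SU2) : 0 ≤ dist x y := Real.sqrt_nonneg _

theorem dist_mul_right (x y z : SU2) : dist (x * z) (y * z) = dist x y := by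
  have hz := Matrix.mem_unitaryGroup_iff.mp (Matrix.mem_specialUnitaryGroup_iff.mp z.2).1
  have h : ((x * z : SU2) : Matrix (Fin 2) (Fin 2) ℂ) - ((y * z : SU2) : Matrix (Fin 2) (Fin 2) ℂ)
      = (x.1 - y.1) * z.1 := by
    rw [sub_mul]; rfl
  rw [dist, dist, h, Matrix.conjTranspose_mul, mul_assoc, ← mul_assoc z.1,
    ← Matrix.star_eq_conjTranspose z.1, hz, one_mul]

theorem dist_eq_sqrt (x y : SU2) : dist x y =
    Real.sqrt (Complex.normSq (x.1 0 0 - y.1 0 0) + Complex.normSq (x.1 0 1 - y.1 0 1)) := by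
  rw [dist]
  congr 1
  simp [Matrix.trace, Fin.sum_univ_two, Matrix.mul_apply, apply_one_zero, apply_one_one,
    Complex.normSq_apply]
  ring

/-- The eigenvalue map is a contraction: identifying `SU(2)` with the unit sphere of
`ℝ⁴ = ℝ × ℝ³`, it is `(t, v) ↦ t + i ‖v‖`. -/
theorem norm_eigenvalue_sub_le (x y : SU2) : ‖eigenvalue x - eigenvalue y‖ ≤ dist x y := by
  rw [dist_eq_sqrt, Complex.norm_def]
  apply Real.sqrt_le_sqrt
  have hx := normSq_add_normSq x
  have hy := normSq_add_normSq y
  simp only [Complex.normSq_apply, eigenvalue, Complex.sub_re, Complex.sub_im] at hx hy ⊢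
  have hsx := Real.mul_self_sqrt (sub_nonneg.mpr (re_sq_le_one x))
  have hsy := Real.mul_self_sqrt (sub_nonneg.mpr (re_sq_le_one y))
  have px := Real.sqrt_nonneg (1 - (x.1 0 0).re ^ 2)
  have py := Real.sqrt_nonneg (1 - (y.1 0 0).re ^ 2)
  generalize Real.sqrt (1 - (x.1 0 0).re ^ 2) = s at *
  generalize Real.sqrt (1 - (y.1 0 0).re ^ 2) = s' at *
  generalize (x.1 0 0).re = t at *
  generalize (y.1 0 0).re = t' at *
  generalize (x.1 0 0).im = a at *
  generalize (y.1 0 0).im = a' at *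
  generalize (x.1 0 1).re = b at *
  generalize (y.1 0 1).re = b' at *
  generalize (x.1 0 1).im = c at *
  generalize (y.1 0 1).im = c' at *
  -- Cauchy-Schwarz for the imaginary parts
  have key : a * a' + b * b' + c * c' ≤ s * s' := by
    refine le_of_abs_le (abs_le_of_sq_le_sq ?_ (mul_nonneg px py))
    have h1 : s * s = a * a + b * b + c * c := by linarith
    have h2 : s' * s' = a' * a' + b' * b' + c' * c' := by linarith
    have h3 : (s * s') ^ 2 = (a * a + b * b + c * c) * (a' * a' + b' * b' + c' * c') := by
      rw [← h1, ← h2]; ring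
    rw [h3]
    nlinarith [sq_nonneg (a * b' - b * a'), sq_nonneg (a * c' - c * a'),
      sq_nonneg (b * c' - c * b')]
  nlinarith

/-! ### Binary forms and the characters of `SU(2)` -/

/-- The exponent of the monomial `z₀ ^ (n - i) * z₁ ^ i`. -/
def exponent (n : ℕ) (i : Fin (n + 1)) : Fin 2 →₀ ℕ :=
  Finsupp.single 0 (n - i) + Finsupp.single 1 (i : ℕ)

theorem exponent_injective (n : ℕ) : Function.Injective (exponent n) := by
  intro i j h
  have := DFunLike.congr_fun h 1
  simpa [exponent, Fin.val_inj] using this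

theorem degree_exponent (n : ℕ) (i : Fin (n + 1)) : (exponent n i).degree = n := by
  rw [Finsupp.degree_eq_sum, Fin.sum_univ_two]
  have := i.2
  simp [exponent]
  omega

theorem exists_exponent_eq {n : ℕ} {d : Fin 2 →₀ ℕ} (hd : d.degree = n) :
    ∃ i, exponent n i = d := by
  rw [Finsupp.degree_eq_sum, Fin.sum_univ_two] at hd
  refine ⟨⟨d 1, by omega⟩, ?_⟩
  ext j
  fin_cases j <;> simp [exponent]
  omega

theorem monomial_exponent_mem (n : ℕ) (i : Fin (n + 1)) (c : ℂ) :
    MvPolynomial.monomial (exponent n i) c ∈ MvPolynomial.homogeneousSubmodule (Fin 2) ℂ n :=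
  MvPolynomial.isHomogeneous_monomial c (degree_exponent n i)

theorem coeff_sum_monomial_exponent {n : ℕ} (c : Fin (n + 1) → ℂ) (i : Fin (n + 1)) :
    MvPolynomial.coeff (exponent n i) (∑ j, MvPolynomial.monomial (exponent n j) (c j)) = c i := by
  rw [MvPolynomial.coeff_sum, Finset.sum_eq_single i]
  · simp
  · intro j _ hj
    rw [MvPolynomial.coeff_monomial, if_neg fun h => hj (exponent_injective n h)]
  · simp

theorem eq_sum_monomial_exponent {n : ℕ} {p : MvPolynomial (Fin 2) ℂ} (hp : p.IsHomogeneous n) :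
    p = ∑ i, MvPolynomial.monomial (exponent n i) (p.coeff (exponent n i)) := by
  ext d
  by_cases hd : d.degree = n
  · obtain ⟨i, rfl⟩ := exists_exponent_eq hd
    rw [coeff_sum_monomial_exponent]
  · rw [hp.coeff_eq_zero hd, MvPolynomial.coeff_sum, Finset.sum_eq_zero]
    intro i _
    rw [MvPolynomial.coeff_monomial, if_neg]
    rintro rfl
    exact hd (degree_exponent n i)

/-- Binary forms of degree `n` correspond to their coefficient vectors. -/
def formEquiv (n : ℕ) : MvPolynomial.homogeneousSubmodule (Fin 2) ℂ n ≃ₗ[ℂ] (Fin (n + 1) → ℂ) where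
  toFun p i := MvPolynomial.coeff (exponent n i) p.1
  map_add' p q := by ext i; simp
  map_smul' c p := by ext i; simp
  invFun c := ⟨∑ i, MvPolynomial.monomial (exponent n i) (c i),
    Submodule.sum_mem _ fun i _ => monomial_exponent_mem n i (c i)⟩
  left_inv p := Subtype.ext (eq_sum_monomial_exponent p.2).symm
  right_inv c := funext fun i => coeff_sum_monomial_exponent c i

theorem character_eq_sum_coeff (n : ℕ) (x : SU2) :
    (irrep n).character x = ∑ i, MvPolynomial.coeff (exponent n i)
      (subst x.1 (MvPolynomial.monomial (exponent n i) 1)) := by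
  let b := Module.Basis.ofEquivFun (formEquiv n)
  have hb (i : Fin (n + 1)) : (b i).1 = MvPolynomial.monomial (exponent n i) 1 := by
    simp only [b, Module.Basis.coe_ofEquivFun]
    change ∑ j, MvPolynomial.monomial (exponent n j) ((Pi.single i (1 : ℂ) : _ → ℂ) j) = _
    rw [Finset.sum_eq_single i] <;> simp +contextual
  rw [Representation.character, LinearMap.trace_eq_matrix_trace ℂ b, Matrix.trace]
  refine Finset.sum_congr rfl fun i _ => ?_
  rw [Matrix.diag_apply, LinearMap.toMatrix_apply, ← hb]
  rfl

theorem eval_eq_sum {n : ℕ} {p : MvPolynomial (Fin 2) ℂ} (hp : p.IsHomogeneous n)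
    (z : Fin 2 → ℂ) : MvPolynomial.eval z p =
      ∑ i : Fin (n + 1), p.coeff (exponent n i) * (z 0 ^ (n - i) * z 1 ^ (i : ℕ)) := by
  conv_lhs => rw [eq_sum_monomial_exponent hp]
  rw [map_sum]
  refine Finset.sum_congr rfl fun i _ => ?_
  rw [MvPolynomial.eval_monomial, Finsupp.prod_fintype _ _ (by simp), Fin.prod_univ_two]
  simp [exponent]

theorem subst_diagonal (a b : ℂ) (n : ℕ) (i : Fin (n + 1)) :
    subst !![a, 0; 0, b] (MvPolynomial.monomial (exponent n i) 1) =
      MvPolynomial.monomial (exponent n i) (a ^ (n - i) * b ^ (i : ℕ)) := by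
  have h (c : ℂ) : MvPolynomial.monomial (exponent n i) c =
      MvPolynomial.C c * (MvPolynomial.X 0 ^ (n - i) * MvPolynomial.X 1 ^ (i : ℕ)) := by
    rw [MvPolynomial.monomial_eq, Finsupp.prod_fintype _ _ (by simp), Fin.prod_univ_two]
    simp [exponent]
  rw [h, h]
  simp [subst, Fin.sum_univ_two, mul_pow]
  ring

/-- The complete homogeneous symmetric polynomial of degree `n` in `a, b`: the trace of the
`n`-th symmetric power of a matrix with eigenvalues `a, b`. -/
def hsum (n : ℕ) (a b : ℂ) : ℂ := ∑ i ∈ Finset.range (n + 1), a ^ (n - i) * b ^ i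

theorem character_eq_hsum (n : ℕ) (x : SU2) :
    (irrep n).character x = hsum n (eigenvalue x) (conj (eigenvalue x)) := by
  obtain ⟨h, d, hx, hd⟩ := exists_conj_diagonal x
  have hc : (irrep n).character x = (irrep n).character d := by
    conv_lhs => rw [hx]
    rw [Representation.char_mul_comm, inv_mul_cancel_left]
  rw [hc, character_eq_sum_coeff, hd, hsum,
    Finset.sum_range fun i => eigenvalue x ^ (n - i) * conj (eigenvalue x) ^ i]
  refine Finset.sum_congr rfl fun i _ => ?_
  rw [subst_diagonal, MvPolynomial.coeff_monomial, if_pos rfl]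

theorem continuous_character (n : ℕ) : Continuous fun x => (irrep n).character x := by
  simp only [character_eq_hsum, hsum]
  have := continuous_eigenvalue
  have := Complex.continuous_conj.comp this
  fun_prop

/-! ### Vanishing of the integrals of the nontrivial characters -/

instance isHaarMeasure_haar : haar.IsHaarMeasure := by
  unfold haar; infer_instance

instance isProbabilityMeasure_haar : IsProbabilityMeasure haar :=
  ⟨Measure.haarMeasure_self⟩

theorem integrable_of_continuous {f : SU2 → ℂ} (hf : Continuous f) : Integrable f haar :=
  hf.integrable_of_hasCompactSupport (HasCompactSupport.of_compactSpace f)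

theorem continuous_coeff_subst (p : MvPolynomial (Fin 2) ℂ) (d : Fin 2 →₀ ℕ) :
    Continuous fun x : SU2 => MvPolynomial.coeff d (subst x.1 p) := by
  classical
  induction p using MvPolynomial.induction_on generalizing d with
  | C a => simpa [subst, MvPolynomial.algebraMap_eq] using continuous_const
  | add p q hp hq =>
    simp only [map_add, MvPolynomial.coeff_add]
    exact (hp d).add (hq d)
  | mul_X p j hp =>
    simp only [map_mul, MvPolynomial.coeff_mul]
    refine continuous_finsetSum _ fun e _ => (hp e.1).mul ?_
    simp only [subst, MvPolynomial.aeval_X, MvPolynomial.coeff_sum, MvPolynomial.coeff_C_mul]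
    exact continuous_finsetSum _ fun i _ => (continuous_apply i j).mul continuous_const

theorem eval_subst (A : Matrix (Fin 2) (Fin 2) ℂ) (p : MvPolynomial (Fin 2) ℂ) (z : Fin 2 → ℂ) :
    MvPolynomial.eval z (subst A p) = MvPolynomial.eval (Matrix.vecMul z A) p := by
  induction p using MvPolynomial.induction_on with
  | C a => simp [subst, MvPolynomial.algebraMap_eq]
  | add p q hp hq => simp [hp, hq]
  | mul_X p j hp =>
    rw [map_mul, map_mul, hp, map_mul]
    simp [subst, Matrix.vecMul, dotProduct, mul_comm]

/-- The average `z ↦ ∫ p (z g) dμ(g)` of a binary form is the form with averaged coefficients. -/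
theorem integral_eval_vecMul {n : ℕ} {p : MvPolynomial (Fin 2) ℂ} (hp : p.IsHomogeneous n)
    (z : Fin 2 → ℂ) :
    ∫ x : SU2, MvPolynomial.eval (Matrix.vecMul z x.1) p ∂haar =
      ∑ i : Fin (n + 1), (∫ x : SU2, MvPolynomial.coeff (exponent n i) (subst x.1 p) ∂haar) *
        (z 0 ^ (n - i) * z 1 ^ (i : ℕ)) := by
  have h (x : SU2) := eval_eq_sum (subst_mem x.1 p hp) z
  simp only [AlgHom.toLinearMap_apply] at h
  simp only [← eval_subst, h]
  rw [integral_finsetSum]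
  · exact Finset.sum_congr rfl fun i _ => integral_mul_const _ _
  · exact fun i _ => integrable_of_continuous ((continuous_coeff_subst p _).mul continuous_const)

/-- The average of a binary form over `SU(2)` is invariant under `SU(2)`. -/
theorem integral_eval_vecMul_vecMul (p : MvPolynomial (Fin 2) ℂ) (z : Fin 2 → ℂ) (y : SU2) :
    ∫ x : SU2, MvPolynomial.eval (Matrix.vecMul (Matrix.vecMul z y.1) x.1) p ∂haar =
      ∫ x : SU2, MvPolynomial.eval (Matrix.vecMul z x.1) p ∂haar := by
  rw [← integral_mul_left_eq_self (fun x : SU2 => MvPolynomial.eval (Matrix.vecMul z x.1) p) y]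
  simp only [Matrix.vecMul_vecMul]
  rfl

/-- There are no nonzero invariant binary forms of positive degree `n`: such a form `q` satisfies
`q (1, w) = 2 ^ (n / 2) * q (1, 0)` for all `w` on the unit circle, hence for all `w`, and `w = 0`
gives `q (1, 0) = 0`. -/
theorem integral_coeff_subst {n : ℕ} (hn : n ≠ 0) {p : MvPolynomial (Fin 2) ℂ}
    (hp : p.IsHomogeneous n) (i : Fin (n + 1)) :
    ∫ x : SU2, MvPolynomial.coeff (exponent n i) (subst x.1 p) ∂haar = 0 := by
  have hF := integral_eval_vecMul hp
  set c : Fin (n + 1) → ℂ := fun i =>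
    ∫ x : SU2, MvPolynomial.coeff (exponent n i) (subst x.1 p) ∂haar with hc
  change ∀ z : Fin 2 → ℂ, _ = ∑ i, c i * (z 0 ^ (n - i) * z 1 ^ (i : ℕ)) at hF
  change c i = 0
  have hs : ((Real.sqrt 2 : ℝ) : ℂ) * (Real.sqrt 2 : ℝ) = 2 := by
    rw [← Complex.ofReal_mul, Real.mul_self_sqrt (by norm_num)]; norm_num
  have hs0 : ((Real.sqrt 2 : ℝ) : ℂ) ≠ 0 := by
    intro h; rw [h] at hs; norm_num at hs
  have hcirc (w : ℂ) (hw : Complex.normSq w = 1) :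
      ∑ i : Fin (n + 1), c i * w ^ (i : ℕ) = (Real.sqrt 2 : ℝ) ^ n * c 0 := by
    have hrow : Complex.normSq ((Real.sqrt 2 : ℝ) : ℂ)⁻¹ +
        Complex.normSq (((Real.sqrt 2 : ℝ) : ℂ)⁻¹ * w) = 1 := by
      rw [Complex.normSq_mul, hw, Complex.normSq_inv, Complex.normSq_ofReal,
        Real.mul_self_sqrt (by norm_num)]
      norm_num
    have hinv := integral_eval_vecMul_vecMul p ![1, 0] (ofRow _ _ hrow)
    rw [hF, hF] at hinv
    have hv : Matrix.vecMul ![1, 0] (ofRow _ _ hrow).1 =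
        ![((Real.sqrt 2 : ℝ) : ℂ)⁻¹, ((Real.sqrt 2 : ℝ) : ℂ)⁻¹ * w] := by
      ext j
      fin_cases j <;> simp [coe_ofRow, Matrix.vecMul, dotProduct]
    rw [hv, Fin.sum_univ_succ (n := n)
      (f := fun i => c i * ((![1, 0] : Fin 2 → ℂ) 0 ^ (n - i.1) * ![1, 0] 1 ^ i.1))] at hinv
    simp only [Matrix.cons_val_zero, Matrix.cons_val_one, Matrix.cons_val_fin_one, one_pow,
      Fin.val_succ, Fin.val_zero, pow_zero, mul_one, zero_pow (Nat.succ_ne_zero _), mul_zero,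
      Finset.sum_const_zero, add_zero] at hinv
    rw [← hinv, Finset.mul_sum]
    refine Finset.sum_congr rfl fun i _ => ?_
    have hi : (((Real.sqrt 2 : ℝ) : ℂ)⁻¹) ^ (n - i.1) * ((Real.sqrt 2 : ℝ) : ℂ)⁻¹ ^ i.1 =
        (((Real.sqrt 2 : ℝ) : ℂ) ^ n)⁻¹ := by
      rw [← pow_add, Nat.sub_add_cancel (Nat.lt_succ_iff.mp i.2), inv_pow]
    have hn0 := pow_ne_zero n hs0
    rw [mul_pow, ← mul_assoc ((((Real.sqrt 2 : ℝ) : ℂ)⁻¹) ^ (n - i.1)), hi]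
    field_simp
  let q : Polynomial ℂ := ∑ i : Fin (n + 1), Polynomial.C (c i) * Polynomial.X ^ (i : ℕ)
  have hcoeff (i : Fin (n + 1)) : q.coeff i = c i := by
    simp only [q, Polynomial.finsetSum_coeff, Polynomial.coeff_C_mul_X_pow]
    rw [Finset.sum_eq_single i] <;> simp +contextual [Fin.val_inj, eq_comm]
  have hq : q = Polynomial.C ((Real.sqrt 2 : ℝ) ^ n * c 0) := by
    apply Polynomial.eq_of_infinite_eval_eq
    have hinf : (Metric.sphere (0 : ℂ) 1).Infinite := by
      refine (isPreconnected_sphere ?_ 0 1).infinite_of_nontrivial ⟨1, by simp, -1, by simp, ?_⟩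
      · rw [Complex.rank_real_complex]; norm_num
      · norm_num
    refine hinf.mono fun w hw => ?_
    have hw' : Complex.normSq w = 1 := by
      rw [Complex.normSq_eq_norm_sq, mem_sphere_zero_iff_norm.mp hw, one_pow]
    simpa [q, Polynomial.eval_finsetSum] using hcirc w hw'
  have h0 : c 0 = 0 := by
    have h := hcoeff 0
    rw [hq] at h
    simp only [Fin.val_zero, Polynomial.coeff_C_zero] at h
    have hne : ((Real.sqrt 2 : ℝ) : ℂ) ^ n ≠ 1 := by
      rw [← Complex.ofReal_pow]
      have : (1 : ℝ) < Real.sqrt 2 ^ n :=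
        one_lt_pow₀ (Real.lt_sqrt_of_sq_lt (by norm_num)) hn
      exact_mod_cast this.ne'
    have h' : (((Real.sqrt 2 : ℝ) : ℂ) ^ n - 1) * c 0 = 0 := by linear_combination h
    exact (mul_eq_zero.mp h').resolve_left (sub_ne_zero.mpr hne)
  rw [← hcoeff, hq, h0]
  simp

theorem integral_character (n : ℕ) :
    ∫ x, (irrep n).character x ∂haar = if n = 0 then 1 else 0 := by
  split_ifs with h
  · subst h
    simp [character_eq_hsum, hsum]
  · simp only [character_eq_sum_coeff]
    rw [integral_finsetSum]
    · exact Finset.sum_eq_zero fun i _ =>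
        integral_coeff_subst h (monomial_exponent_mem n i 1) i
    · exact fun i _ => integrable_of_continuous (continuous_coeff_subst _ _)

/-! ### The test functions `2 cos (m θ)` -/

/-- The terms of the sum on the left are cut into the first `n + 1`, the middle `r` and the last
`n + 1`; for `r > 0` the middle ones add up to `hsum (r - 1) a b`. -/
theorem hsum_eq_add {a b : ℂ} (hab : a * b = 1) (n r : ℕ) :
    hsum (n + 1 + r + n) a b = (a ^ (n + 1 + r) + b ^ (n + 1 + r)) * hsum n a b +
      ∑ j ∈ Finset.range r, a ^ (r - 1 - j) * b ^ j := by
  have hsplit : n + 1 + r + n + 1 = (n + 1) + r + (n + 1) := by ring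
  rw [hsum, hsplit, Finset.sum_range_add, Finset.sum_range_add, hsum, add_mul, Finset.mul_sum,
    Finset.mul_sum]
  have h1 : ∀ i ∈ Finset.range (n + 1), a ^ (n + 1 + r + n - i) * b ^ i =
      a ^ (n + 1 + r) * (a ^ (n - i) * b ^ i) := by
    intro i hi
    rw [Finset.mem_range] at hi
    rw [← mul_assoc, ← pow_add]
    congr 2
    omega
  have h2 : ∀ j ∈ Finset.range r, a ^ (n + 1 + r + n - (n + 1 + j)) * b ^ (n + 1 + j) =
      a ^ (r - 1 - j) * b ^ j := by
    intro j hj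
    rw [Finset.mem_range] at hj
    have he : n + 1 + r + n - (n + 1 + j) = (n + 1) + (r - 1 - j) := by omega
    have hp : a ^ (n + 1) * b ^ (n + 1) = 1 := by rw [← mul_pow, hab, one_pow]
    rw [he, pow_add, pow_add b]
    linear_combination (a ^ (r - 1 - j) * b ^ j) * hp
  have h3 : ∀ i ∈ Finset.range (n + 1),
      a ^ (n + 1 + r + n - (n + 1 + r + i)) * b ^ (n + 1 + r + i) =
      b ^ (n + 1 + r) * (a ^ (n - i) * b ^ i) := by
    intro i _
    rw [Nat.add_sub_add_left, pow_add b]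
    ring
  rw [Finset.sum_congr rfl h1, Finset.sum_congr rfl h2, Finset.sum_congr rfl h3]
  ring

/-- The class function with value `2 cos (m θ)` at the elements with eigenvalues `e ^ (± i θ)`. -/
def cosine (m : ℕ) (x : SU2) : ℝ := 2 * (eigenvalue x ^ m).re

theorem ofReal_cosine (m : ℕ) (x : SU2) :
    (cosine m x : ℂ) = eigenvalue x ^ m + conj (eigenvalue x) ^ m := by
  rw [← map_pow, Complex.add_conj, cosine]

theorem cosine_inv (m : ℕ) (x : SU2) : cosine m x⁻¹ = cosine m x := by
  rw [cosine, eigenvalue_inv, cosine]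

theorem continuous_cosine (m : ℕ) : Continuous (cosine m) :=
  continuous_const.mul (Complex.continuous_re.comp (continuous_eigenvalue.pow m))

/-- This is the identity `2 cos (m θ) χ_n = χ_{m + n} - χ_{m - n - 2}`, integrated. -/
theorem integral_character_mul_cosine {n m : ℕ} (h : n < m) :
    ∫ x, (irrep n).character x * (cosine m x : ℂ) ∂haar = if n + 2 = m then -1 else 0 := by
  obtain ⟨r, rfl⟩ := Nat.exists_eq_add_of_le (Nat.succ_le_of_lt h)
  rw [Nat.succ_eq_add_one] at *
  have hpt (x : SU2) : (irrep n).character x * (cosine (n + 1 + r) x : ℂ) =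
      (irrep (n + 1 + r + n)).character x -
        ∑ j ∈ Finset.range r, eigenvalue x ^ (r - 1 - j) * conj (eigenvalue x) ^ j := by
    rw [character_eq_hsum, character_eq_hsum, hsum_eq_add (eigenvalue_mul_conj x), ofReal_cosine]
    ring
  simp only [hpt]
  cases r with
  | zero =>
    simp only [Finset.range_zero, Finset.sum_empty, sub_zero]
    rw [integral_character, if_neg (by omega), if_neg (by omega)]
  | succ s =>
    have hs (x : SU2) : ∑ j ∈ Finset.range (s + 1),
        eigenvalue x ^ (s + 1 - 1 - j) * conj (eigenvalue x) ^ j = (irrep s).character x := by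
      rw [character_eq_hsum, hsum, Nat.add_sub_cancel]
    simp only [hs]
    rw [integral_sub (integrable_of_continuous (continuous_character _))
      (integrable_of_continuous (continuous_character _)), integral_character, integral_character,
      if_neg (by omega)]
    by_cases h0 : s = 0
    · rw [if_pos h0, if_pos (by omega), zero_sub]
    · rw [if_neg h0, if_neg (by omega), sub_zero]

theorem continuous_dirichletKernel (N : ℕ) : Continuous (dirichletKernel N) :=
  continuous_finsetSum _ fun n _ => continuous_const.mul (continuous_character n)

theorem integral_dirichletKernel_mul_cosine (k : ℕ) :
    ∫ x, dirichletKernel (k + 1) x * (cosine (k + 2) x : ℂ) ∂haar = -((k : ℂ) + 1) := by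
  simp only [dirichletKernel, Finset.sum_mul, mul_assoc]
  rw [integral_finsetSum]
  · simp only [integral_const_mul]
    rw [Finset.sum_eq_single k]
    · rw [integral_character_mul_cosine (by omega), if_pos rfl, mul_neg_one]
    · intro n hn hnk
      rw [Finset.mem_range] at hn
      rw [integral_character_mul_cosine hn, if_neg (by omega), mul_zero]
    · intro hk
      exact absurd (Finset.mem_range.mpr (by omega)) hk
  · exact fun n _ => integrable_of_continuous (continuous_const.mul ((continuous_character n).mul
      (Complex.continuous_ofReal.comp (continuous_cosine _))))

theorem norm_pow_sub_pow_le {a b : ℂ} (ha : ‖a‖ = 1) (hb : ‖b‖ = 1) (m : ℕ) :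
    ‖a ^ m - b ^ m‖ ≤ m * ‖a - b‖ := by
  rw [← (Commute.all a b).geom_sum₂_mul, norm_mul]
  refine mul_le_mul_of_nonneg_right ((norm_sum_le _ _).trans ?_) (norm_nonneg _)
  simp [ha, hb]

theorem abs_cosine_le (m : ℕ) (x : SU2) : |cosine m x| ≤ 2 := by
  rw [cosine, abs_mul, abs_two]
  have := Complex.abs_re_le_norm (eigenvalue x ^ m)
  rw [norm_pow, norm_eigenvalue, one_pow] at this
  linarith

theorem abs_cosine_sub_le {α : ℝ} (hα0 : 0 < α) (hα1 : α < 1) (m : ℕ) (x y : SU2) :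
    |cosine m x - cosine m y| ≤ 4 * (m : ℝ) ^ α * dist x y ^ α := by
  have hd := dist_nonneg x y
  have hu : 0 ≤ (m : ℝ) * dist x y := by positivity
  have h1 : |cosine m x - cosine m y| ≤ 4 := by
    have := abs_sub (cosine m x) (cosine m y)
    linarith [abs_cosine_le m x, abs_cosine_le m y]
  have h2 : |cosine m x - cosine m y| ≤ 2 * (m * dist x y) := by
    rw [cosine, cosine, ← mul_sub, ← Complex.sub_re, abs_mul, abs_two]
    refine mul_le_mul_of_nonneg_left ((Complex.abs_re_le_norm _).trans ?_) zero_le_two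
    exact (norm_pow_sub_pow_le (norm_eigenvalue x) (norm_eigenvalue y) m).trans
      (mul_le_mul_of_nonneg_left (norm_eigenvalue_sub_le x y) m.cast_nonneg)
  rw [mul_assoc, ← Real.mul_rpow m.cast_nonneg hd]
  rcases le_total 1 ((m : ℝ) * dist x y) with h | h
  · have := Real.one_le_rpow h hα0.le
    linarith
  · have := Real.rpow_le_rpow_of_exponent_ge_of_imp hu h hα1.le (by intro _ h'; linarith)
    rw [Real.rpow_one] at this
    linarith

/-! ### Condensation of singularities -/

/-- Condensation of singularities, for countably many families of functionals on a complete
bounded convex set in place of a Banach space. -/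
theorem exists_mem_forall_unbounded {V W : Type*} [NormedAddCommGroup V] [NormedSpace ℝ V]
    [NormedAddCommGroup W] [NormedSpace ℝ W] {K : Set V} (hK : IsComplete K)
    (hconv : Convex ℝ K) (hbdd : Bornology.IsBounded K) (hne : K.Nonempty)
    {ι κ : Type*} [Countable ι] (T : ι → κ → V →L[ℝ] W)
    (h : ∀ i, ∀ B : ℝ, ∃ g ∈ K, ∃ k, B < ‖T i k g‖) :
    ∃ f ∈ K, ∀ i, ∀ B : ℝ, ∃ k, B < ‖T i k f‖ := by
  by_contra! hcon
  have : CompleteSpace K := hK.completeSpace_coe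
  have : Nonempty K := hne.to_subtype
  let F : ι × ℕ → Set K := fun p => {f | ∀ k, ‖T p.1 k f‖ ≤ p.2}
  have hF (p : ι × ℕ) : IsClosed (F p) := by
    simp only [F, Set.ofPred_forall]
    exact isClosed_iInter fun k => isClosed_le
      ((T p.1 k).continuous.comp continuous_subtype_val).norm continuous_const
  have hU : ⋃ p, F p = Set.univ := by
    refine Set.eq_univ_of_forall fun f => ?_
    obtain ⟨i, B, hB⟩ := hcon f f.2
    obtain ⟨n, hn⟩ := exists_nat_ge B
    exact Set.mem_iUnion.mpr ⟨(i, n), fun k => (hB k).trans hn⟩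
  obtain ⟨⟨i, n⟩, f₀, hf₀⟩ := nonempty_interior_of_iUnion_of_closed hF hU
  obtain ⟨ε, hε, hball⟩ := Metric.mem_nhds_iff.mp (mem_interior_iff_mem_nhds.mp hf₀)
  obtain ⟨C, hC⟩ := hbdd.exists_norm_le
  have hC0 : 0 ≤ C := (norm_nonneg _).trans (hC f₀ f₀.2)
  -- moving from `f₀` towards any `g ∈ K` by the proportion `t` stays in the ball
  obtain ⟨t, ht0, ht1, htε⟩ : ∃ t : ℝ, 0 < t ∧ t ≤ 1 ∧ t * (2 * C) < ε := by
    refine ⟨min 1 (ε / (2 * C + 1)), by positivity, min_le_left _ _, ?_⟩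
    calc min 1 (ε / (2 * C + 1)) * (2 * C) ≤ ε / (2 * C + 1) * (2 * C) :=
          mul_le_mul_of_nonneg_right (min_le_right _ _) (by positivity)
      _ < ε := by
          rw [div_mul_eq_mul_div, div_lt_iff₀ (by positivity)]
          nlinarith
  obtain ⟨g, hg, k, hk⟩ := h i (2 * n / t)
  have hmem : (1 - t) • (f₀ : V) + t • g ∈ K :=
    hconv f₀.2 hg (by linarith) ht0.le (by ring)
  have hdist : (⟨_, hmem⟩ : K) ∈ Metric.ball f₀ ε := by
    rw [Metric.mem_ball, Subtype.dist_eq, dist_eq_norm]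
    have : (1 - t) • (f₀ : V) + t • g - f₀ = t • (g - f₀) := by module
    rw [this, norm_smul, Real.norm_of_nonneg ht0.le]
    refine lt_of_le_of_lt (mul_le_mul_of_nonneg_left ?_ ht0.le) htε
    linarith [norm_sub_le g f₀, hC g hg, hC f₀ f₀.2]
  have h1 : ‖T i k ((1 - t) • (f₀ : V) + t • g)‖ ≤ n := hball hdist k
  have h2 : ‖T i k f₀‖ ≤ n := hball (Metric.mem_ball_self hε) k
  have h3 : t • T i k g = T i k ((1 - t) • (f₀ : V) + t • g) - (1 - t) • T i k f₀ := by
    rw [map_add, map_smul, map_smul, add_sub_cancel_left]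
  have h4 : t * ‖T i k g‖ ≤ n + n := by
    calc t * ‖T i k g‖ = ‖t • T i k g‖ := by rw [norm_smul, Real.norm_of_nonneg ht0.le]
      _ ≤ ‖T i k ((1 - t) • (f₀ : V) + t • g)‖ + ‖(1 - t) • T i k f₀‖ := by
        rw [h3]; exact norm_sub_le _ _
      _ ≤ n + n := by
        refine add_le_add h1 ?_
        rw [norm_smul, Real.norm_of_nonneg (by linarith)]
        exact (mul_le_of_le_one_left (norm_nonneg _) (by linarith)).trans h2
  rw [div_lt_iff₀ ht0] at hk
  linarith

/-! ### Fourier partial sums as functionals on the Hölder ball -/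

theorem integrable_fourierPartialSum (N : ℕ) (x : SU2) (f : C(SU2, ℝ)) :
    Integrable (fun y => dirichletKernel N y * (f (y⁻¹ * x) : ℂ)) haar :=
  integrable_of_continuous ((continuous_dirichletKernel N).mul (by fun_prop))

/-- The functional `f ↦ S_N f (x)` on the continuous functions. -/
def fourierFunctional (N : ℕ) (x : SU2) : C(SU2, ℝ) →L[ℝ] ℂ :=
  LinearMap.mkContinuous
    { toFun := fun f => fourierPartialSum N f x
      map_add' := fun f g => by
        simp only [fourierPartialSum]
        rw [← integral_add (integrable_fourierPartialSum N x f)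
          (integrable_fourierPartialSum N x g)]
        simp only [ContinuousMap.add_apply, Complex.ofReal_add, mul_add]
      map_smul' := fun c f => by
        simp only [fourierPartialSum, RingHom.id_apply, Complex.real_smul]
        rw [← integral_const_mul]
        simp only [ContinuousMap.smul_apply, smul_eq_mul, Complex.ofReal_mul, mul_left_comm] }
    (∫ y, ‖dirichletKernel N y‖ ∂haar) fun f => by
      change ‖∫ y, dirichletKernel N y * (f (y⁻¹ * x) : ℂ) ∂haar‖ ≤ _
      rw [← integral_mul_const]
      refine norm_integral_le_of_norm_le
        ((integrable_of_continuous (continuous_dirichletKernel N)).norm.mul_const _)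
        (Filter.Eventually.of_forall fun y => ?_)
      rw [norm_mul, Complex.norm_real]
      exact mul_le_mul_of_nonneg_left (f.norm_coe_le_norm _) (norm_nonneg _)

theorem fourierFunctional_apply (N : ℕ) (x : SU2) (f : C(SU2, ℝ)) :
    fourierFunctional N x f = fourierPartialSum N f x := rfl

/-- The unit ball of `Lip_α(SU(2))` for the Hölder norm, as a set of continuous functions. -/
def holderBall (α : ℝ) : Set C(SU2, ℝ) :=
  {f | (∀ x, |f x| ≤ 1) ∧ ∀ x y, |f x - f y| ≤ dist x y ^ α}

theorem isClosed_holderBall (α : ℝ) : IsClosed (holderBall α) := by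
  simp only [holderBall, Set.ofPred_and, Set.ofPred_forall]
  refine IsClosed.inter (isClosed_iInter fun x => ?_)
    (isClosed_iInter fun x => isClosed_iInter fun y => ?_)
  · exact isClosed_le (by fun_prop) continuous_const
  · exact isClosed_le (by fun_prop) continuous_const

theorem convex_holderBall (α : ℝ) : Convex ℝ (holderBall α) := by
  intro f hf g hg a b ha hb hab
  refine ⟨fun x => ?_, fun x y => ?_⟩
  · calc |(a • f + b • g) x| = |a * f x + b * g x| := rfl
      _ ≤ a * |f x| + b * |g x| := by
        refine (abs_add_le _ _).trans_eq ?_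
        rw [abs_mul, abs_mul, abs_of_nonneg ha, abs_of_nonneg hb]
      _ ≤ a * 1 + b * 1 := by gcongr <;> [exact hf.1 x; exact hg.1 x]
      _ = 1 := by linarith
  · calc |(a • f + b • g) x - (a • f + b • g) y| = |a * (f x - f y) + b * (g x - g y)| := by
          simp only [ContinuousMap.add_apply, ContinuousMap.smul_apply, smul_eq_mul]
          ring_nf
      _ ≤ a * |f x - f y| + b * |g x - g y| := by
        refine (abs_add_le _ _).trans_eq ?_
        rw [abs_mul, abs_mul, abs_of_nonneg ha, abs_of_nonneg hb]
      _ ≤ a * dist x y ^ α + b * dist x y ^ α := by gcongr <;> [exact hf.2 x y; exact hg.2 x y]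
      _ = dist x y ^ α := by rw [← add_mul, hab, one_mul]

theorem isBounded_holderBall (α : ℝ) : Bornology.IsBounded (holderBall α) :=
  isBounded_iff_forall_norm_le.mpr ⟨1, fun f hf =>
    (ContinuousMap.norm_le f zero_le_one).mpr fun x => (Real.norm_eq_abs _).trans_le (hf.1 x)⟩

theorem zero_mem_holderBall (α : ℝ) : 0 ∈ holderBall α :=
  ⟨fun x => by simp, fun x y => by simpa using Real.rpow_nonneg (dist_nonneg x y) α⟩

/-- The function `2 cos (m θ)` centred at `x` and normalized in `Lip_α`, for `m = k + 2`. -/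
def testFunction (α : ℝ) (x : SU2) (k : ℕ) : C(SU2, ℝ) where
  toFun y := (4 * ((k + 2 : ℕ) : ℝ) ^ α)⁻¹ * cosine (k + 2) (y * x⁻¹)
  continuous_toFun := by
    have := continuous_cosine (k + 2)
    fun_prop

theorem testFunction_mem_holderBall {α : ℝ} (hα0 : 0 < α) (hα1 : α < 1) (x : SU2) (k : ℕ) :
    testFunction α x k ∈ holderBall α := by
  have hm : (1 : ℝ) ≤ ((k + 2 : ℕ) : ℝ) ^ α :=
    Real.one_le_rpow (by exact_mod_cast Nat.succ_le_succ (Nat.zero_le _)) hα0.le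
  have hpos : 0 < 4 * ((k + 2 : ℕ) : ℝ) ^ α := by linarith
  refine ⟨fun y => ?_, fun y z => ?_⟩
  · change |(4 * ((k + 2 : ℕ) : ℝ) ^ α)⁻¹ * cosine (k + 2) (y * x⁻¹)| ≤ 1
    rw [abs_mul, abs_of_pos (inv_pos.mpr hpos), inv_mul_le_iff₀ hpos]
    linarith [abs_cosine_le (k + 2) (y * x⁻¹)]
  · change |(4 * ((k + 2 : ℕ) : ℝ) ^ α)⁻¹ * cosine (k + 2) (y * x⁻¹) -
      (4 * ((k + 2 : ℕ) : ℝ) ^ α)⁻¹ * cosine (k + 2) (z * x⁻¹)| ≤ _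
    rw [← mul_sub, abs_mul, abs_of_pos (inv_pos.mpr hpos), inv_mul_le_iff₀ hpos,
      ← dist_mul_right y z x⁻¹]
    exact abs_cosine_sub_le hα0 hα1 _ _ _

theorem fourierPartialSum_testFunction (α : ℝ) (x : SU2) (k : ℕ) :
    fourierPartialSum (k + 1) (testFunction α x k) x =
      -(((4 * ((k + 2 : ℕ) : ℝ) ^ α)⁻¹ * (k + 1) : ℝ) : ℂ) := by
  have h (y : SU2) : dirichletKernel (k + 1) y * (testFunction α x k (y⁻¹ * x) : ℂ) =
      (((4 * ((k + 2 : ℕ) : ℝ) ^ α)⁻¹ : ℝ) : ℂ) *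
        (dirichletKernel (k + 1) y * (cosine (k + 2) y : ℂ)) := by
    change _ * (((4 * ((k + 2 : ℕ) : ℝ) ^ α)⁻¹ * cosine (k + 2) (y⁻¹ * x * x⁻¹) : ℝ) : ℂ) = _
    rw [mul_inv_cancel_right, cosine_inv, Complex.ofReal_mul]
    ring
  simp only [fourierPartialSum, h]
  rw [integral_const_mul, integral_dirichletKernel_mul_cosine]
  push_cast
  ring

theorem exists_lt_norm_fourierPartialSum {α : ℝ} (hα0 : 0 < α) (hα1 : α < 1) (x : SU2) (B : ℝ) :
    ∃ g ∈ holderBall α, ∃ N : {N : ℕ // 1 ≤ N}, B < ‖fourierFunctional N x g‖ := by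
  have ht := (tendsto_rpow_atTop (sub_pos.mpr hα1)).comp
    (Filter.tendsto_atTop_add_const_right _ (1 : ℝ) tendsto_natCast_atTop_atTop)
  obtain ⟨k, hk⟩ := (ht.eventually_gt_atTop (8 * B)).exists
  refine ⟨testFunction α x k, testFunction_mem_holderBall hα0 hα1 x k, ⟨k + 1, by omega⟩, ?_⟩
  have hk1 : (0 : ℝ) < (k : ℝ) + 1 := by positivity
  have hp1 : 0 < ((k : ℝ) + 1) ^ α := Real.rpow_pos_of_pos hk1 α
  have hp2 : 0 < ((k + 2 : ℕ) : ℝ) ^ α := Real.rpow_pos_of_pos (by positivity) α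
  have hle : ((k + 2 : ℕ) : ℝ) ^ α ≤ 2 * ((k : ℝ) + 1) ^ α := by
    calc ((k + 2 : ℕ) : ℝ) ^ α ≤ (2 * ((k : ℝ) + 1)) ^ α := by
          refine Real.rpow_le_rpow (by positivity) ?_ hα0.le
          push_cast
          linarith [(Nat.cast_nonneg k : (0 : ℝ) ≤ k)]
      _ = 2 ^ α * ((k : ℝ) + 1) ^ α := Real.mul_rpow zero_le_two hk1.le
      _ ≤ 2 * ((k : ℝ) + 1) ^ α := by
          refine mul_le_mul_of_nonneg_right ?_ hp1.le
          simpa using Real.rpow_le_rpow_of_exponent_le one_le_two hα1.le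
  rw [fourierFunctional_apply, fourierPartialSum_testFunction, norm_neg, Complex.norm_real,
    Real.norm_of_nonneg (by positivity), lt_inv_mul_iff₀ (by positivity)]
  simp only [Function.comp_apply, Real.rpow_sub hk1, Real.rpow_one] at hk
  rw [lt_div_iff₀ hp1] at hk
  rcases le_or_gt B 0 with hB | hB
  · nlinarith
  · nlinarith

end SUTwo

end

theorem mainTheorem4 (α : ℝ) (hα0 : 0 < α) (hα1 : α < 1)
    (E : Set SUTwo.SU2) (hE : E.Countable) :
    ∃ f : SUTwo.SU2 → ℝ, SUTwo.IsHolder α f ∧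
      ∀ x ∈ E, (⨆ (N : ℕ) (_ : 1 ≤ N), ‖SUTwo.fourierPartialSum N f x‖ₑ) = ⊤ := by
  have : Countable E := hE.to_subtype
  obtain ⟨f, hf, hunb⟩ := SUTwo.exists_mem_forall_unbounded
    (SUTwo.isClosed_holderBall α).isComplete (SUTwo.convex_holderBall α)
    (SUTwo.isBounded_holderBall α) ⟨0, SUTwo.zero_mem_holderBall α⟩
    (fun (x : E) (N : {N : ℕ // 1 ≤ N}) => SUTwo.fourierFunctional N x)
    (fun x => SUTwo.exists_lt_norm_fourierPartialSum hα0 hα1 x)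
  refine ⟨f, ⟨1, one_pos, fun x y => (hf.2 x y).trans_eq (one_mul _).symm⟩, fun x hx => ?_⟩
  refine ENNReal.eq_top_of_forall_nnreal_le fun r => ?_
  obtain ⟨N, hN⟩ := hunb ⟨x, hx⟩ r
  refine le_iSup₂_of_le N.1 N.2 ?_
  rw [enorm_eq_nnnorm, ENNReal.coe_le_coe]
  exact hN.le
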